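/- Let $(M,g,J)$ be a Kähler surface (real dimension $4$), oriented by $J$, with Levi-Civita connection $\nabla$ and curvature $R(X,Y)Z=\nabla_X\nabla_YZ-\nabla_Y\nabla_XZ-\nabla_{[X,Y]}Z$, $R(X,Y,Z,W)=g(R(X,Y)Z,W)$. Assume that $(M,g,J)$ is QCH (of quasi-constant holomorphic sectional curvature) with respect to a smooth $J$-invariant $2$-dimensional distribution $\mathcal D\subset TM$: for every $x\in M$ and every unit vector $X\in T_xM$, the holomorphic sectional curvature $R(X,JX,JX,X)$ depends only on $x$ and on the norm $|X_{\mathcal D}|$ of the orthogonal projection of $X$ to $\mathcal D$. Let $\overline J$ be the opposite almost Hermitian structure with $\overline J=-J$ on $\mathcal D$ and $\overline J=J$ on $\mathcal D^{\perp}$, let $\overline\omega(X,Y)=g(\overline JX,Y)$, let $W^-$ be the anti-self-dual Weyl tensor, and let $\kappa$ be the conformal scalar curvature of $(M,g,\overline J)$, that is, the function with $\langle W^-\overline\omega,\overline\omega\rangle=\frac{\kappa}{6}\langle\overline\omega,\overline\omega\rangle$, where $W^-$ acts on $2$-forms by $(W^-\alpha)(X,Y)=\frac12\sum_{i,j}\alpha(e_i,e_j)W^-(e_i,e_j,Y,X)$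 in an orthonormal basis. For a $4$-covariant tensor $T$ write $(R(X,Y).T)(Z_1,\dots,Z_4)=-\sum_{i=1}^4T(\dots,R(X,Y)Z_i,\dots)$, and $R.T=0$ if $R(X,Y).T=0$ for all $X,Y$. If $R.W^-=0$ and $\kappa(x)\neq0$ for every $x\in M$, then $(M,g,J)$ is semi-symmetric, i.e. $R.R=0$. -/

import Mathlib

open Bundle
open scoped Manifold ContDiff Topology

noncomputable section

/-! ## Algebra on one Euclidean vector space

In this part `V` stands for a tangent space with its inner product `g`, covariant tensors are
functions of several vectors of `V`, and all contractions are taken in an orthonormal basis. -/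

namespace KahlerAlg

section Algebra

variable {V : Type*} [NormedAddCommGroup V] [InnerProductSpace ℝ V]

/-- `(A.T)(X, Y, Z, U) = -T(AX, Y, Z, U) - T(X, AY, Z, U) - T(X, Y, AZ, U) - T(X, Y, Z, AU)`: the
action of an endomorphism `A`, as a derivation, on a 4-covariant tensor `T`. -/
def derivAction (A : V → V) (T : V → V → V → V → ℝ) (x y z u : V) : ℝ :=
  -T (A x) y z u - T x (A y) z u - T x y (A z) u - T x y z (A u)

/-- The fundamental 2-form `ω(X, Y) = g(JX, Y)` of an endomorphism `J`. -/
def fundForm (J : V → V) (x y : V) : ℝ := inner ℝ (J x) y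

/-- The 4-form `½ ω ∧ ω`, where `ω` is the fundamental form of `J`. On a 4-dimensional `V` with an
orthogonal complex structure `J` it is the volume form of the orientation defined by `J`. -/
def volForm (J : V → V) (x y z u : V) : ℝ :=
  fundForm J x y * fundForm J z u - fundForm J x z * fundForm J y u
    + fundForm J x u * fundForm J y z

variable [FiniteDimensional ℝ V]

/-- The Ricci contraction `Ric(Y, Z) = ∑ᵢ R(eᵢ, Y, Z, eᵢ)`. -/
def ricci (R : V → V → V → V → ℝ) (y z : V) : ℝ :=
  ∑ i, R (stdOrthonormalBasis ℝ V i) y z (stdOrthonormalBasis ℝ V i)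

/-- The scalar curvature `τ = ∑ᵢ Ric(eᵢ, eᵢ)`. -/
def scalarCurv (R : V → V → V → V → ℝ) : ℝ :=
  ∑ i, ricci R (stdOrthonormalBasis ℝ V i) (stdOrthonormalBasis ℝ V i)

/-- The Weyl tensor of a curvature tensor `R` in dimension 4. -/
def weyl (R : V → V → V → V → ℝ) (x y z u : V) : ℝ :=
  R x y z u
    - (1 / 2 : ℝ) * (inner ℝ y z * ricci R x u - inner ℝ x z * ricci R y u
        + ricci R y z * inner ℝ x u - ricci R x z * inner ℝ y u)
    + scalarCurv R / 6 * (inner ℝ y z * inner ℝ x u - inner ℝ x z * inner ℝ y u)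

/-- The Hodge star of the orientation defined by `J`, on 2-forms of a 4-dimensional space:
`(⋆α)(X, Y) = ½ ∑ᵢⱼ α(eᵢ, eⱼ) vol(eᵢ, eⱼ, X, Y)`. -/
def hodgeStar (J : V → V) (α : V → V → ℝ) (x y : V) : ℝ :=
  (1 / 2 : ℝ) * ∑ i, ∑ j, α (stdOrthonormalBasis ℝ V i) (stdOrthonormalBasis ℝ V j)
    * volForm J (stdOrthonormalBasis ℝ V i) (stdOrthonormalBasis ℝ V j) x y

/-- The anti-self-dual Weyl tensor `W⁻ = ½ (W - ⋆W)`, for the orientation defined by `J` (for which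
the fundamental form of `J` is self-dual). -/
def weylMinus (J : V → V) (R : V → V → V → V → ℝ) (x y z u : V) : ℝ :=
  (1 / 2 : ℝ) * (weyl R x y z u - hodgeStar J (fun a b => weyl R a b z u) x y)

/-- The orthogonal almost complex structure `J̄` which is opposite to `J` and adapted to a
`J`-invariant plane `D`: `J̄ = -J` on `D` and `J̄ = J` on the orthogonal complement of `D`. -/
def oppositeJ (J : V → V) (D : Submodule ℝ V) (x : V) : V :=
  J (x - D.starProjection x) - J (D.starProjection x)

/-- The conformal scalar curvature `κ` of an almost complex structure `I` opposite to `J`.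
With `ω̄` the fundamental form of `I`, and `W⁻` acting on 2-forms by
`(W⁻ α)(X, Y) = ½ ∑ᵢⱼ α(eᵢ, eⱼ) W⁻(eᵢ, eⱼ, Y, X)`, it is determined by
`⟨W⁻ ω̄, ω̄⟩ = κ / 6 * ⟨ω̄, ω̄⟩`, where `⟨α, β⟩ = ½ ∑ᵢⱼ α(eᵢ, eⱼ) β(eᵢ, eⱼ)`, hence
`⟨ω̄, ω̄⟩ = 2`. -/
def conformalScalar (J I : V → V) (R : V → V → V → V → ℝ) : ℝ :=
  3 * ((1 / 4 : ℝ) * ∑ i, ∑ j, ∑ k, ∑ l,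
    fundForm I (stdOrthonormalBasis ℝ V i) (stdOrthonormalBasis ℝ V j)
      * fundForm I (stdOrthonormalBasis ℝ V k) (stdOrthonormalBasis ℝ V l)
      * weylMinus J R (stdOrthonormalBasis ℝ V i) (stdOrthonormalBasis ℝ V j)
          (stdOrthonormalBasis ℝ V l) (stdOrthonormalBasis ℝ V k))

end Algebra

end KahlerAlg

/-! ## Kähler surfaces -/

namespace KahlerSurface

section Geometry

variable {M : Type*} [TopologicalSpace M] [ChartedSpace (EuclideanSpace ℝ (Fin 4)) M]
  [IsManifold (𝓡 4) ∞ M]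

/-- The Riemann curvature
`R(X, Y)Z = ∇_X ∇_Y Z - ∇_Y ∇_X Z - ∇_[X,Y] Z` of a connection on the tangent bundle, at the
point `x`; the tangent vectors `u, v, w` at `x` are extended to vector fields that are smooth
near `x` (the result does not depend on the extensions). Mathlib writes `∇ σ x u` for `∇_u σ`. -/
def curvature (nabla : CovariantDerivative (𝓡 4) (EuclideanSpace ℝ (Fin 4))
      (TangentSpace (𝓡 4) : M → Type _))
    (x : M) (u v w : TangentSpace (𝓡 4) x) : TangentSpace (𝓡 4) x :=
  let X : Π y : M, TangentSpace (𝓡 4) y := FiberBundle.extend (EuclideanSpace ℝ (Fin 4)) u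
  let Y : Π y : M, TangentSpace (𝓡 4) y := FiberBundle.extend (EuclideanSpace ℝ (Fin 4)) v
  let Z : Π y : M, TangentSpace (𝓡 4) y := FiberBundle.extend (EuclideanSpace ℝ (Fin 4)) w
  nabla (fun y => nabla Z y (Y y)) x (X x) - nabla (fun y => nabla Z y (X y)) x (Y x)
    - nabla Z x (VectorField.mlieBracket (𝓡 4) X Y x)

instance finiteDimensional_tangentSpace (x : M) : FiniteDimensional ℝ (TangentSpace (𝓡 4) x) :=
  inferInstanceAs (FiniteDimensional ℝ (EuclideanSpace ℝ (Fin 4)))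

variable [RiemannianBundle (fun x : M => TangentSpace (𝓡 4) x)]

instance riemannianBundle_one
    [h : IsContMDiffRiemannianBundle (𝓡 4) ∞ (EuclideanSpace ℝ (Fin 4))
      (fun x : M => TangentSpace (𝓡 4) x)] :
    IsContMDiffRiemannianBundle (𝓡 4) 1 (EuclideanSpace ℝ (Fin 4))
      (fun x : M => TangentSpace (𝓡 4) x) :=
  h.of_le (by exact_mod_cast le_top)

/-- The 4-covariant curvature tensor `R(X, Y, Z, W) = g(R(X, Y)Z, W)`. -/
def curvature4 (nabla : CovariantDerivative (𝓡 4) (EuclideanSpace ℝ (Fin 4))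
      (TangentSpace (𝓡 4) : M → Type _))
    (x : M) (u v w z : TangentSpace (𝓡 4) x) : ℝ :=
  inner ℝ (curvature nabla x u v w) z

/-- `nabla` is the Levi-Civita connection of the Riemannian metric: the smooth connection on the
tangent bundle that is compatible with the metric and torsion-free. -/
structure IsLeviCivita
    [IsContMDiffRiemannianBundle (𝓡 4) ∞ (EuclideanSpace ℝ (Fin 4))
      (fun x : M => TangentSpace (𝓡 4) x)]
    (nabla : CovariantDerivative (𝓡 4) (EuclideanSpace ℝ (Fin 4))
      (TangentSpace (𝓡 4) : M → Type _)) : Prop where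
  smooth : nabla.ContMDiffCovariantDerivative ∞
  metric : nabla.IsMetricCompatible
  torsion_free : nabla.torsion = 0

/-- `J` is a Kähler structure on the Riemannian manifold `M` with Levi-Civita connection `nabla`: a
smooth orthogonal almost complex structure with `∇J = 0`. -/
structure IsKahler
    (nabla : CovariantDerivative (𝓡 4) (EuclideanSpace ℝ (Fin 4))
      (TangentSpace (𝓡 4) : M → Type _))
    (J : Π x : M, TangentSpace (𝓡 4) x →L[ℝ] TangentSpace (𝓡 4) x) : Prop where
  smooth : ContMDiff (𝓡 4)
    ((𝓡 4).prod 𝓘(ℝ, EuclideanSpace ℝ (Fin 4) →L[ℝ] EuclideanSpace ℝ (Fin 4))) ∞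
    (fun x => TotalSpace.mk' (EuclideanSpace ℝ (Fin 4) →L[ℝ] EuclideanSpace ℝ (Fin 4))
      (E := fun x : M => TangentSpace (𝓡 4) x →L[ℝ] TangentSpace (𝓡 4) x) x (J x))
  sq : ∀ (x : M) (u : TangentSpace (𝓡 4) x), J x (J x u) = -u
  orthogonal : ∀ (x : M) (u v : TangentSpace (𝓡 4) x), inner ℝ (J x u) (J x v) = inner ℝ u v
  parallel : ∀ (X : Π x : M, TangentSpace (𝓡 4) x) (x : M), 
    MDifferentiableAt (𝓡 4) ((𝓡 4).prod 𝓘(ℝ, EuclideanSpace ℝ (Fin 4)))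
      (fun y => TotalSpace.mk' (EuclideanSpace ℝ (Fin 4)) y (X y)) x →
    ∀ u : TangentSpace (𝓡 4) x, nabla (fun y => J y (X y)) x u = J x (nabla X x u)

/-- The vector field `X` is smooth on the set `U`. -/
def IsSmoothFieldOn (X : Π y : M, TangentSpace (𝓡 4) y) (U : Set M) : Prop :=
  ContMDiffOn (𝓡 4) ((𝓡 4).prod 𝓘(ℝ, EuclideanSpace ℝ (Fin 4))) ∞
    (fun y => TotalSpace.mk' (EuclideanSpace ℝ (Fin 4)) y (X y)) U

/-- `D` is a smooth distribution of 2-planes on `M`. -/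
structure IsSmoothPlaneField (D : Π x : M, Submodule ℝ (TangentSpace (𝓡 4) x)) : Prop where
  finrank_eq : ∀ x : M, Module.finrank ℝ (D x) = 2
  smooth : ∀ x : M, ∃ U : Set M, IsOpen U ∧ x ∈ U ∧
    ∃ X Y : Π y : M, TangentSpace (𝓡 4) y,
      IsSmoothFieldOn X U ∧ IsSmoothFieldOn Y U ∧ ∀ y ∈ U, D y = Submodule.span ℝ {X y, Y y}

/-- The Kähler surface is QCH (of quasi-constant holomorphic sectional curvature) with respect to
`D`: `D` is a smooth `J`-invariant distribution of 2-planes, and the holomorphic sectional curvature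
`R(X, JX, JX, X)` of a unit vector `X` depends only on its base point and on the norm of its
orthogonal projection to `D`. -/
structure IsQCH
    (nabla : CovariantDerivative (𝓡 4) (EuclideanSpace ℝ (Fin 4))
      (TangentSpace (𝓡 4) : M → Type _))
    (J : Π x : M, TangentSpace (𝓡 4) x →L[ℝ] TangentSpace (𝓡 4) x)
    (D : Π x : M, Submodule ℝ (TangentSpace (𝓡 4) x)) : Prop where
  plane_field : IsSmoothPlaneField D
  invariant : ∀ (x : M), ∀ u ∈ D x, J x u ∈ D x
  holomorphic_curvature : ∃ φ : M → ℝ → ℝ, ∀ (x : M) (u : TangentSpace (𝓡 4) x), ‖u‖ = 1 →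
    curvature4 nabla x u (J x u) (J x u) u = φ x ‖(D x).starProjection u‖

/-- The anti-self-dual Weyl tensor `W⁻` of `(M, g, J)`. -/
def weylMinusTensor
    (nabla : CovariantDerivative (𝓡 4) (EuclideanSpace ℝ (Fin 4))
      (TangentSpace (𝓡 4) : M → Type _))
    (J : Π x : M, TangentSpace (𝓡 4) x →L[ℝ] TangentSpace (𝓡 4) x)
    (x : M) : TangentSpace (𝓡 4) x → TangentSpace (𝓡 4) x → TangentSpace (𝓡 4) x →
      TangentSpace (𝓡 4) x → ℝ :=
  KahlerAlg.weylMinus (fun u => J x u) (curvature4 nabla x)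

/-- The conformal scalar curvature `κ` of the opposite almost Hermitian structure `J̄` given by
`J̄ = -J` on `D` and `J̄ = J` on the orthogonal complement of `D`. -/
def kappa
    (nabla : CovariantDerivative (𝓡 4) (EuclideanSpace ℝ (Fin 4))
      (TangentSpace (𝓡 4) : M → Type _))
    (J : Π x : M, TangentSpace (𝓡 4) x →L[ℝ] TangentSpace (𝓡 4) x)
    (D : Π x : M, Submodule ℝ (TangentSpace (𝓡 4) x)) (x : M) : ℝ :=
  KahlerAlg.conformalScalar (fun u => J x u) (KahlerAlg.oppositeJ (fun u => J x u) (D x))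
    (curvature4 nabla x)

/-- `R.T = 0` for a field `T` of 4-covariant tensors: at every point, every curvature endomorphism
`R(X, Y)`, acting as a derivation, annihilates `T`. -/
def CurvatureAnnihilates
    (nabla : CovariantDerivative (𝓡 4) (EuclideanSpace ℝ (Fin 4))
      (TangentSpace (𝓡 4) : M → Type _))
    (T : Π x : M, TangentSpace (𝓡 4) x → TangentSpace (𝓡 4) x → TangentSpace (𝓡 4) x →
      TangentSpace (𝓡 4) x → ℝ) : Prop :=
  ∀ (x : M) (u v z₁ z₂ z₃ z₄ : TangentSpace (𝓡 4) x),
    KahlerAlg.derivAction (curvature nabla x u v) (T x) z₁ z₂ z₃ z₄ = 0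

/-- `(M, g)` is semi-symmetric: `R.R = 0`. -/
def IsSemiSymmetric
    (nabla : CovariantDerivative (𝓡 4) (EuclideanSpace ℝ (Fin 4))
      (TangentSpace (𝓡 4) : M → Type _)) : Prop :=
  CurvatureAnnihilates nabla (curvature4 nabla)

end Geometry

end KahlerSurface

end

/-! The statement is pointwise algebra. A Kähler curvature tensor takes values in the `J`-invariant
2-forms, spanned by `ω` and the three-dimensional space of anti-self-dual forms. In a unitary frame
it is thus a symmetric 4×4 matrix `C` (`exists_eq_frameTensor`), whose lower 3×3 block has trace `C
0 0` by the Bianchi identity; the trace-free part of that block is `W⁻` (`weylMinus_frameTensor`).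

A curvature endomorphism fixes `ω` and acts on the anti-self-dual forms as an infinitesimal rotation
about some axis `q`. So `R.W⁻ = 0` says that a trace-free symmetric 3×3 matrix is invariant under
all these rotations. Invariance about two independent axes would make it scalar, hence zero
(`RotationInvariant.cross_eq_zero`). As `κ ≠ 0` forces `W⁻ ≠ 0`, all axes are parallel, including
the axis `(C 0 1, C 0 2, C 0 3)` obtained by contracting `R` with `ω`. Each rotation therefore fixes
the mixed part of `C` as well as its 3×3 block, which gives `R.R = 0`
(`derivAction_eq_zero_of_weylMinus`).

The geometric half derives the algebraic symmetries of the curvature from the Levi-Civita and Kähler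
conditions. -/

noncomputable section

/-! ### Unitary frames, and Kähler curvature tensors as symmetric matrices. -/

namespace KahlerAlg

section Frames

variable {V : Type*} [NormedAddCommGroup V] [InnerProductSpace ℝ V]

/-- The trace of a bilinear form does not depend on the orthonormal basis. -/
lemma sum_orthonormalBasis_eq {ι κ : Type*} [Fintype ι] [Fintype κ]
    (a : OrthonormalBasis ι ℝ V) (b : OrthonormalBasis κ ℝ V) (f : V → V → ℝ)
    (hl : ∀ y, IsLinearMap ℝ fun x => f x y) (hr : ∀ x, IsLinearMap ℝ (f x)) :
    ∑ i, f (a i) (a i) = ∑ j, f (b j) (b j) := by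
  have hexp : ∀ x y, f x y = ∑ j, inner ℝ (b j) y * f x (b j) := fun x y => by
    conv_lhs => rw [← b.sum_repr' y]
    change (hr x).mk' _ _ = _
    rw [map_sum]
    simp
  have hexp' : ∀ x y, f x y = ∑ j, inner ℝ (a j) x * f (a j) y := fun x y => by
    conv_lhs => rw [← a.sum_repr' x]
    change (hl y).mk' _ _ = _
    rw [map_sum]
    simp
  calc ∑ i, f (a i) (a i) = ∑ i, ∑ j, inner ℝ (b j) (a i) * f (a i) (b j) :=
        Finset.sum_congr rfl fun i _ => hexp _ _
    _ = ∑ j, ∑ i, inner ℝ (a i) (b j) * f (a i) (b j) := by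
        rw [Finset.sum_comm]
        simp only [real_inner_comm]
    _ = ∑ j, f (b j) (b j) := Finset.sum_congr rfl fun j _ => (hexp' _ _).symm

/-- A unitary frame `e₀, Je₀, e₂, Je₂` of a 4-dimensional Hermitian space. -/
lemma exists_unitary_frame (hV : Module.finrank ℝ V = 4) (J : V →ₗ[ℝ] V)
    (hJ2 : ∀ x, J (J x) = -x) (hJ : ∀ x y, inner ℝ (J x) (J y) = (inner ℝ x y : ℝ)) :
    ∃ b : OrthonormalBasis (Fin 4) ℝ V, J (b 0) = b 1 ∧ J (b 2) = b 3 := by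
  have : FiniteDimensional ℝ V := Module.finite_of_finrank_pos (by omega)
  have hskew : ∀ x y, inner ℝ (J x) y = -(inner ℝ x (J y) : ℝ) := fun x y => by
    rw [← hJ x, hJ2, inner_neg_right, neg_neg]
  have hself : ∀ x, inner ℝ x (J x) = (0 : ℝ) := fun x => by
    have := hskew x x
    rw [real_inner_comm] at this
    linarith
  have : Nontrivial V := Module.nontrivial_of_finrank_pos (R := ℝ) (by omega)
  obtain ⟨e, he⟩ := exists_norm_eq (E := V) zero_le_one
  -- This span has dimension at most 2, so a unit vector `f` orthogonal to it exists; `J f` is then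
  -- orthogonal to it too, because `J` is skew.
  set K : Submodule ℝ V := Submodule.span ℝ (Set.range ![e, J e])
  have hK : Module.finrank ℝ K ≤ 2 := finrank_range_le_card (R := ℝ) ![e, J e]
  have hKo : Nontrivial Kᗮ := by
    apply Module.nontrivial_of_finrank_pos (R := ℝ)
    have := K.finrank_add_finrank_orthogonal
    omega
  obtain ⟨⟨f, hfK⟩, hf⟩ := exists_norm_eq (E := Kᗮ) zero_le_one
  replace hf : ‖f‖ = 1 := hf
  rw [Submodule.mem_orthogonal] at hfK
  have h1 : inner ℝ e f = (0 : ℝ) := hfK _ (Submodule.subset_span ⟨0, rfl⟩)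
  have h2 : inner ℝ (J e) f = (0 : ℝ) := hfK _ (Submodule.subset_span ⟨1, rfl⟩)
  have h3 : inner ℝ e (J f) = (0 : ℝ) := by linarith [hskew e f]
  have hnorm : ∀ x, ‖J x‖ = ‖x‖ := fun x => by rw [norm_eq_sqrt_real_inner, hJ,
      ← norm_eq_sqrt_real_inner]
  have hself' : ∀ x, inner ℝ (J x) x = (0 : ℝ) := fun x => by rw [real_inner_comm, hself]
  have h1' : inner ℝ f e = (0 : ℝ) := by rw [real_inner_comm, h1]
  have h2' : inner ℝ f (J e) = (0 : ℝ) := by rw [real_inner_comm, h2]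
  have h3' : inner ℝ (J f) e = (0 : ℝ) := by rw [real_inner_comm, h3]
  have hon : Orthonormal ℝ ![e, J e, f, J f] := by
    rw [orthonormal_iff_ite]
    intro i j
    fin_cases i <;> fin_cases j <;>
      simp [hJ, he, hf, h1, h2, h3, hself, h1', h2', h3', hself', hnorm]
  refine ⟨(basisOfOrthonormalOfCardEqFinrank hon (by simp [hV])).toOrthonormalBasis
    (by simpa using hon), ?_, ?_⟩ <;> simp

/-- The coordinates of a vector in an orthonormal frame. -/
def coord (b : OrthonormalBasis (Fin 4) ℝ V) (i : Fin 4) (x : V) : ℝ := inner ℝ (b i) x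

/-- A basis of the 2-forms invariant under the complex structure `J` with `Jb₀ = b₁`, `Jb₂ = b₃`:
the fundamental form of `J`, followed by three anti-self-dual forms. -/
def frameForm (b : OrthonormalBasis (Fin 4) ℝ V) (a : Fin 4) (x y : V) : ℝ :=
  ![coord b 0 x * coord b 1 y - coord b 1 x * coord b 0 y
      + (coord b 2 x * coord b 3 y - coord b 3 x * coord b 2 y),
    coord b 0 x * coord b 1 y - coord b 1 x * coord b 0 y
      - (coord b 2 x * coord b 3 y - coord b 3 x * coord b 2 y),
    coord b 0 x * coord b 2 y - coord b 2 x * coord b 0 y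
      + (coord b 1 x * coord b 3 y - coord b 3 x * coord b 1 y),
    coord b 0 x * coord b 3 y - coord b 3 x * coord b 0 y
      - (coord b 1 x * coord b 2 y - coord b 2 x * coord b 1 y)] a

variable (b : OrthonormalBasis (Fin 4) ℝ V)

lemma coord_add (i : Fin 4) (x y : V) : coord b i (x + y) = coord b i x + coord b i y :=
  inner_add_right ..

lemma coord_smul (i : Fin 4) (c : ℝ) (x : V) : coord b i (c • x) = c * coord b i x := by
  simp [coord, inner_smul_right]

lemma coord_basis (i j : Fin 4) : coord b i (b j) = if i = j then 1 else 0 :=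
  orthonormal_iff_ite.mp b.orthonormal i j

lemma inner_eq_coord (x y : V) : (inner ℝ x y : ℝ) = coord b 0 x * coord b 0 y
    + coord b 1 x * coord b 1 y + coord b 2 x * coord b 2 y + coord b 3 x * coord b 3 y := by
  rw [← b.sum_inner_mul_inner x y, Fin.sum_univ_four]
  simp only [coord, real_inner_comm]

variable {b} {J : V →ₗ[ℝ] V}

lemma fundForm_eq_frameForm (hJ2 : ∀ x, J (J x) = -x) (h0 : J (b 0) = b 1) (h2 : J (b 2) = b 3) :
    fundForm J = frameForm b 0 := by
  have h1 : J (b 1) = -b 0 := by rw [← h0, hJ2]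
  have h3 : J (b 3) = -b 2 := by rw [← h2, hJ2]
  ext x y
  have hx : J x = coord b 0 x • b 1 - coord b 1 x • b 0 +
      (coord b 2 x • b 3 - coord b 3 x • b 2) := by
    conv_lhs => rw [← b.sum_repr' x]
    simp only [map_add, map_smul, Fin.sum_univ_four, h0, h1, h2, h3, coord, smul_neg]
    abel
  simp only [fundForm, hx, inner_add_left, inner_sub_left, real_inner_smul_left]
  simp only [frameForm, coord, Matrix.cons_val_zero]

/-- `J`-invariance forces `f₁₃ = f₀₂` and `f₁₂ = -f₀₃`, so four of the six entries of a 2-form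
remain free. -/
lemma twoForm_eq_frameForm (hJ2 : ∀ x, J (J x) = -x) (h0 : J (b 0) = b 1) (h2 : J (b 2) = b 3)
    (f : V → V → ℝ) (hr : ∀ x, IsLinearMap ℝ (f x)) (hskew : ∀ x y, f x y = -f y x)
    (hinv : ∀ x y, f (J x) (J y) = f x y) (x y : V) :
    f x y = (f (b 0) (b 1) + f (b 2) (b 3)) / 2 * frameForm b 0 x y
      + (f (b 0) (b 1) - f (b 2) (b 3)) / 2 * frameForm b 1 x y
      + f (b 0) (b 2) * frameForm b 2 x y + f (b 0) (b 3) * frameForm b 3 x y := by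
  have h1 : J (b 1) = -b 0 := by rw [← h0, hJ2]
  have h3 : J (b 3) = -b 2 := by rw [← h2, hJ2]
  have hexp : ∀ x y, f x y = ∑ j, coord b j y * f x (b j) := fun x y => by
    conv_lhs => rw [← b.sum_repr' y]
    change (hr x).mk' _ _ = _
    rw [map_sum]
    simp [coord]
  have hneg : ∀ x y, f x (-y) = -f x y := fun x y => (hr x).map_neg y
  have hd : ∀ x, f x x = 0 := fun x => by linarith [hskew x x]
  have e13 : f (b 1) (b 3) = f (b 0) (b 2) := by rw [← h0, ← h2, hinv]
  have e12 : f (b 1) (b 2) = -f (b 0) (b 3) := by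
    rw [← hinv, h1, h2, hskew, hneg, hskew (b 3), neg_neg]
  have hL : ∀ j, f x (b j) = - ∑ i, coord b i x * f (b j) (b i) := fun j => by
    rw [hskew, hexp]
  rw [hexp]
  simp only [hL, Fin.sum_univ_four, hd, hskew (b 1) (b 0), hskew (b 2) (b 0), hskew (b 2) (b 1),
    hskew (b 3) (b 0), hskew (b 3) (b 1), hskew (b 3) (b 2), e13, e12, frameForm]
  simp
  ring

/-- The tensor with the given coefficients in the products of the invariant 2-forms. -/
def frameTensor (b : OrthonormalBasis (Fin 4) ℝ V) (C : Fin 4 → Fin 4 → ℝ) (x y z u : V) : ℝ :=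
  ∑ i, ∑ j, C i j * frameForm b i x y * frameForm b j z u

/-- An algebraic Kähler curvature tensor, in a unitary frame. -/
lemma exists_eq_frameTensor (hJ2 : ∀ x, J (J x) = -x) (h0 : J (b 0) = b 1) (h2 : J (b 2) = b 3)
    (R : V → V → V → V → ℝ) (hlin : ∀ x y z, IsLinearMap ℝ (R x y z))
    (h12 : ∀ x y z u, R x y z u = -R y x z u) (h34 : ∀ x y z u, R x y z u = -R x y u z)
    (hB : ∀ x y z u, R x y z u + R y z x u + R z x y u = 0)
    (hK : ∀ x y z u, R x y (J z) (J u) = R x y z u) :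
    ∃ C : Fin 4 → Fin 4 → ℝ, R = frameTensor b C ∧ (∀ i j, C i j = C j i) ∧
      C 0 0 = C 1 1 + C 2 2 + C 3 3 := by
  -- The usual octahedron argument: four Bianchi identities combined with the two skew symmetries.
  have hpair : ∀ x y z u, R x y z u = R z u x y := fun x y z u => by
    linarith [hB x y z u, hB y z u x, hB z u x y, hB u x y z, h12 x y z u, h34 x y z u,
      h12 y z u x, h34 y z u x, h12 z u x y, h34 z u x y, h12 u x y z, h34 u x y z,
      h12 x z y u, h34 x z y u, h12 y u x z, h34 y u x z, h12 z x u y, h34 z x u y,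
      h12 z x y u, h34 y u z x, h12 u y z x, h12 x z u y]
  have h3 : ∀ z u x y, R x y z u = (R (b 0) (b 1) z u + R (b 2) (b 3) z u) / 2 * frameForm b 0 x y
      + (R (b 0) (b 1) z u - R (b 2) (b 3) z u) / 2 * frameForm b 1 x y
      + R (b 0) (b 2) z u * frameForm b 2 x y + R (b 0) (b 3) z u * frameForm b 3 x y :=
    fun z u x y => by
      refine twoForm_eq_frameForm hJ2 h0 h2 (fun x y => R x y z u) (fun x => ?_)
        (fun x y => h12 x y z u) (fun x y => ?_) x y
      · simpa only [hpair x _ z u] using hlin z u x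
      · simp only [hpair _ _ z u, hK]
  have h4 := fun x y => twoForm_eq_frameForm hJ2 h0 h2 (R x y) (hlin x y) (h34 x y) (hK x y)
  -- The functionals that read off the coefficients of a form in the basis `frameForm b`; applied to
  -- both pairs of slots they give `C`.
  set S : Fin 4 → (V → V → ℝ) → ℝ := fun i f => ![(f (b 0) (b 1) + f (b 2) (b 3)) / 2,
    (f (b 0) (b 1) - f (b 2) (b 3)) / 2, f (b 0) (b 2), f (b 0) (b 3)] i with hS
  refine ⟨fun i j => S i fun x y => S j (R x y), ?_, ?_, ?_⟩
  · ext x y z u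
    rw [h3, h4, h4 (b 2), h4 (b 0) (b 2), h4 (b 0) (b 3)]
    simp only [frameTensor, Fin.sum_univ_four, hS]
    simp
    ring
  · intro i j
    fin_cases i <;> fin_cases j <;> simp [hS] <;>
      linarith [hpair (b 0) (b 1) (b 2) (b 3), hpair (b 0) (b 1) (b 0) (b 2),
        hpair (b 0) (b 1) (b 0) (b 3), hpair (b 2) (b 3) (b 0) (b 2), hpair (b 2) (b 3) (b 0) (b 3),
        hpair (b 0) (b 2) (b 0) (b 3)]
  -- Here `C 0 0 - C 1 1 = R₀₁₂₃`, which Bianchi and `J`-invariance turn into `R₀₂₀₂ + R₀₃₀₃ = C 2 2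
  -- + C 3 3`.
  · have h1' : J (b 1) = -b 0 := by rw [← h0, hJ2]
    have e1 := hB (b 0) (b 1) (b 2) (b 3)
    have e3 : R (b 1) (b 2) (b 0) (b 3) = - R (b 0) (b 3) (b 0) (b 3) := by
      rw [hpair, ← hK, h1', h2, h34, (hlin _ _ _).map_neg, neg_neg, h34]
    have e4 : R (b 2) (b 0) (b 1) (b 3) = - R (b 0) (b 2) (b 0) (b 2) := by
      rw [h12, ← h0, ← h2, hK]
    simp [hS]
    linarith [hpair (b 0) (b 1) (b 2) (b 3)]

end Frames

end KahlerAlg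

/-! ### Ricci contraction, Hodge star and `W⁻` in a unitary frame. -/

namespace KahlerAlg

section Frames

variable {V : Type*} [NormedAddCommGroup V] [InnerProductSpace ℝ V]
  {b : OrthonormalBasis (Fin 4) ℝ V} {J : V →ₗ[ℝ] V}

lemma frameForm_add_left (i : Fin 4) (x x' y : V) :
    frameForm b i (x + x') y = frameForm b i x y + frameForm b i x' y := by
  fin_cases i <;> simp [frameForm, coord_add] <;> ring

lemma frameForm_smul_left (i : Fin 4) (c : ℝ) (x y : V) :
    frameForm b i (c • x) y = c * frameForm b i x y := by
  fin_cases i <;> simp [frameForm, coord_smul] <;> ring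

lemma frameForm_swap (i : Fin 4) (x y : V) : frameForm b i x y = -frameForm b i y x := by
  fin_cases i <;> simp [frameForm] <;> ring

lemma frameForm_add_right (i : Fin 4) (x y y' : V) :
    frameForm b i x (y + y') = frameForm b i x y + frameForm b i x y' := by
  simp only [frameForm_swap i x, frameForm_add_left, neg_add]

lemma frameForm_smul_right (i : Fin 4) (c : ℝ) (x y : V) :
    frameForm b i x (c • y) = c * frameForm b i x y := by
  simp only [frameForm_swap i x, frameForm_smul_left, mul_neg]

variable [FiniteDimensional ℝ V] (C : Fin 4 → Fin 4 → ℝ)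

/-- The Ricci tensor of `frameTensor b C`, in coordinates. -/
lemma ricci_frameTensor (hC : ∀ i j, C i j = C j i) (h0 : C 0 0 = C 1 1 + C 2 2 + C 3 3) (y z : V) :
    ricci (frameTensor b C) y z =
      -(2 * C 0 0) * inner ℝ y z
      - 2 * C 0 1 * (coord b 0 y * coord b 0 z + coord b 1 y * coord b 1 z
          - coord b 2 y * coord b 2 z - coord b 3 y * coord b 3 z)
      + 2 * C 0 2 * (coord b 0 y * coord b 3 z + coord b 3 y * coord b 0 z
          - coord b 1 y * coord b 2 z - coord b 2 y * coord b 1 z)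
      - 2 * C 0 3 * (coord b 0 y * coord b 2 z + coord b 2 y * coord b 0 z
          + coord b 1 y * coord b 3 z + coord b 3 y * coord b 1 z) := by
  rw [ricci, sum_orthonormalBasis_eq _ b (fun x u => frameTensor b C x y z u)]
  · simp only [frameTensor, Fin.sum_univ_four, frameForm, coord_basis, inner_eq_coord b, hC 1 0,
      hC 2 0,
      hC 3 0, hC 2 1, hC 3 1, hC 3 2, h0]
    simp
    ring
  · intro u
    constructor <;> intros <;>
      simp only [frameTensor, frameForm_add_left, frameForm_smul_left, Fin.sum_univ_four,
          smul_eq_mul] <;> ring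
  · intro u
    constructor <;> intros <;>
      simp only [frameTensor, frameForm_add_right, frameForm_smul_right, Fin.sum_univ_four,
          smul_eq_mul] <;> ring

/-- The mixed coefficients enter the Ricci tensor through trace-free forms, so only the multiple `-2
C 0 0` of the metric contributes, four times. -/
lemma scalarCurv_frameTensor (hC : ∀ i j, C i j = C j i) (h0 : C 0 0 = C 1 1 + C 2 2 + C 3 3) :
    scalarCurv (frameTensor b C) = -(8 * C 0 0) := by
  rw [scalarCurv, sum_orthonormalBasis_eq _ b (fun x y => ricci (frameTensor b C) x y)]
  · simp only [ricci_frameTensor C hC h0, Fin.sum_univ_four, coord_basis, inner_eq_coord b]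
    simp
    ring
  · intro u
    constructor <;> intros <;>
      simp only [ricci_frameTensor C hC h0, coord_add, coord_smul, inner_add_left,
          real_inner_smul_left, smul_eq_mul] <;> ring
  · intro u
    constructor <;> intros <;>
      simp only [ricci_frameTensor C hC h0, coord_add, coord_smul, inner_add_right,
          real_inner_smul_right, smul_eq_mul] <;> ring

/-- The Hodge star in a unitary frame. -/
lemma hodgeStar_eq (hJ2 : ∀ x, J (J x) = -x) (hJ0 : J (b 0) = b 1) (hJ2' : J (b 2) = b 3)
    (f : V → V → ℝ) (hl : ∀ y, IsLinearMap ℝ fun x => f x y) (hr : ∀ x, IsLinearMap ℝ (f x))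
    (hskew : ∀ x y, f x y = -f y x) (x y : V) :
    hodgeStar J f x y =
      (f (b 0) (b 1) + f (b 2) (b 3)) / 2 * frameForm b 0 x y
      - (f (b 0) (b 1) - f (b 2) (b 3)) / 2 * frameForm b 1 x y
      + f (b 0) (b 2) * (coord b 3 x * coord b 1 y - coord b 1 x * coord b 3 y)
      + f (b 1) (b 3) * (coord b 2 x * coord b 0 y - coord b 0 x * coord b 2 y)
      + f (b 0) (b 3) * (coord b 1 x * coord b 2 y - coord b 2 x * coord b 1 y)
      + f (b 1) (b 2) * (coord b 0 x * coord b 3 y - coord b 3 x * coord b 0 y) := by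
  have hd : ∀ x, f x x = 0 := fun x => by linarith [hskew x x]
  have hv : volForm J = fun x y z u => frameForm b 0 x y * frameForm b 0 z u
      - frameForm b 0 x z * frameForm b 0 y u + frameForm b 0 x u * frameForm b 0 y z := by
    ext; simp only [volForm, fundForm_eq_frameForm hJ2 hJ0 hJ2']
  have hvl : ∀ q y', IsLinearMap ℝ fun p => volForm J p q x y' := fun q y' => by
    rw [hv]
    constructor <;> intros <;>
      simp only [frameForm_add_left, frameForm_smul_left, smul_eq_mul] <;> ring
  have hvr : ∀ p y', IsLinearMap ℝ fun q => volForm J p q x y' := fun q y' => by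
    rw [hv]
    constructor <;> intros <;>
      simp only [frameForm_add_left, frameForm_add_right, frameForm_smul_left,
        frameForm_smul_right, smul_eq_mul] <;> ring
  -- The basis is changed in one summation index at a time, each time as the trace of a bilinear
  -- form.
  have key : ∀ {n : ℕ} (a : OrthonormalBasis (Fin n) ℝ V),
      ∑ i, ∑ j, f (a i) (a j) * volForm J (a i) (a j) x y
        = ∑ i, ∑ j, f (b i) (b j) * volForm J (b i) (b j) x y := fun a => by
    rw [sum_orthonormalBasis_eq a b (fun p q => ∑ j, f p (a j) * volForm J q (a j) x y)]
    · refine Finset.sum_congr rfl fun i _ =>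
        sum_orthonormalBasis_eq a b (fun p q => f (b i) p * volForm J (b i) q x y) ?_ ?_ <;>
      intro u <;> constructor <;> intros <;>
      simp only [(hr _).map_add, (hr _).map_smul, (hvr _ _).map_add, (hvr _ _).map_smul,
        smul_eq_mul] <;> ring
    all_goals
      intro u
      constructor <;> intros <;>
      simp only [(hl _).map_add, (hl _).map_smul, (hvl _ _).map_add, (hvl _ _).map_smul,
        smul_eq_mul, Finset.mul_sum, ← Finset.sum_add_distrib] <;>
      exact Finset.sum_congr rfl fun i _ => by ring
  rw [hodgeStar, key, hv]
  simp only [Fin.sum_univ_four, frameForm, coord_basis, hd, hskew (b 1) (b 0), hskew (b 2) (b 0),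
      hskew (b 2) (b 1),
    hskew (b 3) (b 0), hskew (b 3) (b 1), hskew (b 3) (b 2)]
  simp
  ring

/-- The coefficients of the anti-self-dual Weyl tensor of `frameTensor b C`. -/
def weylCoeff (C : Fin 4 → Fin 4 → ℝ) (i j : Fin 4) : ℝ :=
  if i = 0 ∨ j = 0 then 0 else if i = j then C i j - C 0 0 / 3 else C i j

/-- The trace-free Ricci part carries exactly the mixed coefficients `C 0 i`, and the self-dual
projection carries `C 0 0`. What survives is the 3×3 block minus its trace part; since the trace is
`C 0 0`, this subtracts `C 0 0 / 3` on the diagonal. -/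
lemma weylMinus_frameTensor (hJ2 : ∀ x, J (J x) = -x) (hJ0 : J (b 0) = b 1) (hJ2' : J (b 2) = b 3)
    (hC : ∀ i j, C i j = C j i) (h0 : C 0 0 = C 1 1 + C 2 2 + C 3 3) :
    weylMinus J (frameTensor b C) = frameTensor b (weylCoeff C) := by
  ext x y z u
  have hw : ∀ x y, weyl (frameTensor b C) x y z u = frameTensor b C x y z u
    - (1 / 2 : ℝ) * (inner ℝ y z * ricci (frameTensor b C) x u
      - inner ℝ x z * ricci (frameTensor b C) y u
        + ricci (frameTensor b C) y z * inner ℝ x u - ricci (frameTensor b C) x z * inner ℝ y u)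
    - 4 / 3 * C 0 0 * (inner ℝ y z * inner ℝ x u - inner ℝ x z * inner ℝ y u) := fun x y => by
    rw [weyl, scalarCurv_frameTensor C hC h0]
    ring
  have hskew : ∀ x y, weyl (frameTensor b C) x y z u = -weyl (frameTensor b C) y x z u :=
    fun x y => by
      have : frameTensor b C x y z u = -frameTensor b C y x z u := by
        simp only [frameTensor, ← Finset.sum_neg_distrib]
        refine Finset.sum_congr rfl fun i _ => Finset.sum_congr rfl fun j _ => ?_
        rw [frameForm_swap i x y]
        ring
      rw [hw, hw, this]
      ring
  have hl : ∀ y, IsLinearMap ℝ fun x => weyl (frameTensor b C) x y z u := fun y => by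
    constructor <;> intros <;>
      simp only [hw, frameTensor, ricci_frameTensor C hC h0, frameForm_add_left,
          frameForm_smul_left, Fin.sum_univ_four, smul_eq_mul, coord_add, coord_smul,
          inner_add_left, real_inner_smul_left] <;> ring
  have hr : ∀ x, IsLinearMap ℝ fun y => weyl (frameTensor b C) x y z u := fun x => by
    constructor <;> intros <;>
      simp only [hskew x, (hl x).map_add, (hl x).map_smul, smul_neg, neg_add]
  rw [weylMinus, hodgeStar_eq hJ2 hJ0 hJ2' _ hl hr hskew]
  simp only [hw, ricci_frameTensor C hC h0]
  simp only [frameTensor, weylCoeff, Fin.sum_univ_four, inner_eq_coord b, coord_basis, frameForm,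
      hC 1 0, hC 2 0,
      hC 3 0, hC 2 1, hC 3 1, hC 3 2, h0]
  simp
  ring

end Frames

end KahlerAlg

/-! ### Curvature endomorphisms as rotations of the anti-self-dual forms. -/

namespace KahlerAlg

section Derivations

variable {V : Type*} [NormedAddCommGroup V] [InnerProductSpace ℝ V]
  {b : OrthonormalBasis (Fin 4) ℝ V}

/-- The action, on the invariant 2-forms, of the skew endomorphism with coefficients `q`. -/
def frameBracket (b : OrthonormalBasis (Fin 4) ℝ V) (q : Fin 4 → ℝ) (i : Fin 4) (x y : V) : ℝ :=
  ![0, 2 * (q 2 * frameForm b 3 x y - q 3 * frameForm b 2 x y),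
    2 * (q 3 * frameForm b 1 x y - q 1 * frameForm b 3 x y),
    2 * (q 1 * frameForm b 2 x y - q 2 * frameForm b 1 x y)] i

variable {A : V → V} {q : Fin 4 → ℝ}

/-- The anti-self-dual forms multiply like imaginary quaternions, so their commutators are, up to
sign, twice the cross product with `(q 1, q 2, q 3)`. The form `ω` is killed, and `q 0` plays no
role, because `J` commutes with all four basis endomorphisms. -/
lemma neg_frameForm_sub_eq_frameBracket
    (hA : ∀ x y, inner ℝ (A x) y = ∑ i, q i * frameForm b i x y) (i : Fin 4) (x y : V) :
    -frameForm b i (A x) y - frameForm b i x (A y) = frameBracket b q i x y := by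
  have hc : ∀ j x, coord b j (A x) = ∑ i, q i * frameForm b i x (b j) := fun j x => by
    rw [← hA, coord, real_inner_comm]
  fin_cases i <;>
  · simp [frameForm, frameBracket, hc, Fin.sum_univ_four, coord_basis]
    ring

lemma derivAction_frameTensor (hA : ∀ x y, inner ℝ (A x) y = ∑ i, q i * frameForm b i x y)
    (C : Fin 4 → Fin 4 → ℝ) (x y z u : V) :
    derivAction A (frameTensor b C) x y z u = ∑ i, ∑ j, C i j *
      (frameBracket b q i x y * frameForm b j z u + frameForm b i x y * frameBracket b q j z u) :=
  by
  simp only [derivAction, frameTensor, ← neg_frameForm_sub_eq_frameBracket hA,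
    ← Finset.sum_neg_distrib, ← Finset.sum_sub_distrib]
  refine Finset.sum_congr rfl fun i _ => Finset.sum_congr rfl fun j _ => ?_
  ring

/-- The symmetric matrix of the anti-self-dual part of `C` commutes with the rotation generator
with axis `q`. -/
structure RotationInvariant (C : Fin 4 → Fin 4 → ℝ) (q : Fin 4 → ℝ) : Prop where
  eq12 : q 1 * C 2 3 = q 2 * C 1 3
  eq23 : q 2 * C 1 3 = q 3 * C 1 2
  eq_12 : q 3 * (C 1 1 - C 2 2) = q 1 * C 1 3 - q 2 * C 2 3
  eq_13 : q 2 * (C 3 3 - C 1 1) = q 3 * C 2 3 - q 1 * C 1 2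
  eq_23 : q 1 * (C 2 2 - C 3 3) = q 2 * C 1 2 - q 3 * C 1 3

/-- On `(b 0, b k)` the only nonzero anti-self-dual basis form is the `k`-th, so evaluation at `(b
0, b k, b 0, b l)` isolates the `(k, l)` entry of the commutator; `hC0` removes the contribution of
`ω`. -/
lemma rotationInvariant_of_derivAction
    (hA : ∀ x y, inner ℝ (A x) y = ∑ i, q i * frameForm b i x y)
    {C : Fin 4 → Fin 4 → ℝ} (hC : ∀ i j, C i j = C j i) (hC0 : ∀ i, C 0 i = 0)
    (h : ∀ x y z u, derivAction A (frameTensor b C) x y z u = 0) : RotationInvariant C q := by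
  have e : ∀ k l : Fin 4, derivAction A (frameTensor b C) (b 0) (b k) (b 0) (b l) = 0 :=
    fun _ _ => h ..
  have h11 := e 1 1
  have h12 := e 1 2
  have h13 := e 1 3
  have h22 := e 2 2
  have h23 := e 2 3
  have h33 := e 3 3
  simp [derivAction_frameTensor hA, Fin.sum_univ_four, hC0, frameForm, frameBracket, coord_basis,
      hC 1 0, hC 2 0, hC 3 0, hC 2 1, hC 3 1, hC 3 2] at h11 h12 h13 h22 h23 h33
  constructor <;> linarith

/-- The rotation acts separately on the vector `(C 0 1, C 0 2, C 0 3)` and on the 3×3 block: the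
first is fixed when it is parallel to the axis, the second by `hq`. -/
lemma derivAction_frameTensor_eq_zero
    (hA : ∀ x y, inner ℝ (A x) y = ∑ i, q i * frameForm b i x y)
    {C : Fin 4 → Fin 4 → ℝ} (hC : ∀ i j, C i j = C j i) (hq : RotationInvariant C q)
    (h12 : q 1 * C 0 2 = q 2 * C 0 1) (h13 : q 1 * C 0 3 = q 3 * C 0 1)
    (h23 : q 2 * C 0 3 = q 3 * C 0 2) (x y z u : V) :
    derivAction A (frameTensor b C) x y z u = 0 := by
  have h1 := hq.eq12
  have h2 := hq.eq23
  have h3 := hq.eq_12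
  have h4 := hq.eq_13
  have h5 := hq.eq_23
  rw [derivAction_frameTensor hA]
  simp only [Fin.sum_univ_four, frameBracket, hC 1 0, hC 2 0, hC 3 0, hC 2 1, hC 3 1, hC 3 2]
  simp
  -- The first three terms treat the mixed part, the next three the diagonal of the commutator, the
  -- last three its off-diagonal entries. The commutator is trace-free, whence `h1 + h2` in the
  -- middle diagonal term.
  linear_combination
    -2 * (frameForm b 0 x y * frameForm b 1 z u + frameForm b 1 x y * frameForm b 0 z u) * h23
    + 2 * (frameForm b 0 x y * frameForm b 2 z u + frameForm b 2 x y * frameForm b 0 z u) * h13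
    - 2 * (frameForm b 0 x y * frameForm b 3 z u + frameForm b 3 x y * frameForm b 0 z u) * h12
    - 4 * frameForm b 3 x y * frameForm b 3 z u * h1
    - 4 * frameForm b 1 x y * frameForm b 1 z u * h2
    + 4 * frameForm b 2 x y * frameForm b 2 z u * (h1 + h2)
    - 2 * (frameForm b 2 x y * frameForm b 3 z u + frameForm b 3 x y * frameForm b 2 z u) * h5
    - 2 * (frameForm b 1 x y * frameForm b 3 z u + frameForm b 3 x y * frameForm b 1 z u) * h4
    - 2 * (frameForm b 1 x y * frameForm b 2 z u + frameForm b 2 x y * frameForm b 1 z u) * h3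

/-- A trace-free symmetric matrix invariant under rotations about two different axes vanishes. -/
lemma RotationInvariant.cross_eq_zero {C : Fin 4 → Fin 4 → ℝ} {q r : Fin 4 → ℝ}
    (hq : RotationInvariant C q) (hr : RotationInvariant C r)
    (htr : C 1 1 + C 2 2 + C 3 3 = 0)
    (hC : ¬ (C 1 1 = 0 ∧ C 2 2 = 0 ∧ C 3 3 = 0 ∧ C 1 2 = 0 ∧ C 1 3 = 0 ∧ C 2 3 = 0)) :
    q 1 * r 2 = q 2 * r 1 ∧ q 1 * r 3 = q 3 * r 1 ∧ q 2 * r 3 = q 3 * r 2 := by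
  obtain ⟨a1, a2, a3, a4, a5⟩ := hq
  obtain ⟨c1, c2, c3, c4, c5⟩ := hr
  -- Cramer's rule for a homogeneous 2×2 system.
  have key : ∀ {p p' s s' x y : ℝ}, p * s' ≠ p' * s → p * x = p' * y → s * x = s' * y →
      x = 0 ∧ y = 0 := fun {p p' s s' x y} hne h1 h2 => by
    have hne : p * s' - p' * s ≠ 0 := sub_ne_zero.mpr hne
    constructor <;> apply mul_left_cancel₀ hne
    · linear_combination s' * h1 - p' * h2
    · linear_combination s * h1 - p * h2
  -- A nonzero component of `q × r` is the determinant of three such systems. They kill the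
  -- off-diagonal entries and the differences of diagonal ones, so the matrix is scalar, and `htr`
  -- makes it zero.
  refine ⟨?_, ?_, ?_⟩ <;> by_contra hne <;> apply hC
  · obtain ⟨h23, h13⟩ := key hne a1 c1
    have := key (x := C 1 2) (y := C 1 1 - C 3 3) hne
      (by rw [h23] at a4; linarith) (by rw [h23] at c4; linarith)
    have := key (x := C 2 2 - C 3 3) (y := C 1 2) hne
      (by rw [h13] at a5; linarith) (by rw [h13] at c5; linarith)
    refine ⟨?_, ?_, ?_, ?_, ?_, ?_⟩ <;> linarith
  · obtain ⟨h23, h12⟩ := key hne (a1.trans a2) (c1.trans c2)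
    have := key (x := C 1 3) (y := C 1 1 - C 2 2) hne
      (by rw [h23] at a3; linarith) (by rw [h23] at c3; linarith)
    have := key (x := C 3 3 - C 2 2) (y := C 1 3) hne
      (by rw [h12] at a5; linarith) (by rw [h12] at c5; linarith)
    refine ⟨?_, ?_, ?_, ?_, ?_, ?_⟩ <;> linarith
  · obtain ⟨h13, h12⟩ := key hne a2 c2
    have := key (x := C 2 3) (y := C 2 2 - C 1 1) hne
      (by rw [h13] at a3; linarith) (by rw [h13] at c3; linarith)
    have := key (x := C 3 3 - C 1 1) (y := C 2 3) hne
      (by rw [h12] at a4; linarith) (by rw [h12] at c4; linarith)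
    refine ⟨?_, ?_, ?_, ?_, ?_, ?_⟩ <;> linarith

/-- If every curvature endomorphism of an algebraic Kähler curvature tensor annihilates its
anti-self-dual Weyl tensor, and the latter does not vanish, then every curvature endomorphism
annihilates the curvature tensor. -/
theorem derivAction_eq_zero_of_weylMinus [FiniteDimensional ℝ V] (hV : Module.finrank ℝ V = 4)
    (J : V →ₗ[ℝ] V) (hJ2 : ∀ x, J (J x) = -x)
    (hJ : ∀ x y, inner ℝ (J x) (J y) = (inner ℝ x y : ℝ)) (Rc : V → V → V → V)
    (R : V → V → V → V → ℝ) (hR : ∀ x y z u, R x y z u = inner ℝ (Rc x y z) u)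
    (h12 : ∀ x y z u, R x y z u = -R y x z u) (h34 : ∀ x y z u, R x y z u = -R x y u z)
    (hB : ∀ x y z u, R x y z u + R y z x u + R z x y u = 0)
    (hK : ∀ x y z u, R x y (J z) (J u) = R x y z u)
    (hne : weylMinus J R ≠ 0)
    (hW : ∀ v w x y z u, derivAction (Rc v w) (weylMinus J R) x y z u = 0)
    (v w x y z u : V) : derivAction (Rc v w) R x y z u = 0 := by
  obtain ⟨b, hb0, hb2⟩ := exists_unitary_frame hV J hJ2 hJ
  obtain ⟨C, rfl, hC, hC0⟩ := exists_eq_frameTensor hJ2 hb0 hb2 R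
    (fun x y z => by
      constructor <;> intros <;> simp [hR, inner_add_right, real_inner_smul_right]) h12 h34 hB hK
  rw [weylMinus_frameTensor C hJ2 hb0 hb2 hC hC0] at hW hne
  have hA : ∀ v w x y, inner ℝ (Rc v w x) y
      = ∑ j, (∑ i, C i j * frameForm b i v w) * frameForm b j x y := fun v w x y => by
    rw [← hR, frameTensor, Finset.sum_comm]
    simp only [Finset.sum_mul]
  have hWC : ∀ i j, weylCoeff C i j = weylCoeff C j i := fun i j => by
    simp only [weylCoeff, hC i j, or_comm, eq_comm]
  have hinv : ∀ v w, RotationInvariant (weylCoeff C) fun j => ∑ i, C i j * frameForm b i v w :=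
    fun v w => rotationInvariant_of_derivAction (hA v w) hWC (by simp [weylCoeff]) (hW v w)
  -- The pairs `(b 0, b 1)` and `(b 2, b 3)` have axes `C 0 + C 1` and `C 0 - C 1`; invariance is
  -- linear in the axis, so it passes to their half-sum.
  have hinv0 : RotationInvariant (weylCoeff C) (C 0) := by
    obtain ⟨a1, a2, a3, a4, a5⟩ := hinv (b 0) (b 1)
    obtain ⟨c1, c2, c3, c4, c5⟩ := hinv (b 2) (b 3)
    simp [Fin.sum_univ_four, frameForm, coord_basis] at a1 a2 a3 a4 a5 c1 c2 c3 c4 c5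
    constructor <;> linarith
  have htr : weylCoeff C 1 1 + weylCoeff C 2 2 + weylCoeff C 3 3 = 0 := by
    simp [weylCoeff]
    linarith
  obtain ⟨e12, e13, e23⟩ := (hinv v w).cross_eq_zero hinv0 htr fun h => hne <| by
    obtain ⟨w11, w22, w33, w12, w13, w23⟩ := h
    have w0 : ∀ i, weylCoeff C 0 i = 0 := by simp [weylCoeff]
    ext
    simp [frameTensor, Fin.sum_univ_four, w0, w11, w22, w33, w12, w13, w23, hWC 1 0, hWC 2 0,
      hWC 3 0, hWC 2 1, hWC 3 1, hWC 3 2]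
  refine derivAction_frameTensor_eq_zero (hA v w) hC ?_ e12 e13 e23 x y z u
  -- Invariance involves only off-diagonal entries and differences of diagonal ones, so the scalar
  -- shift between `weylCoeff C` and the block of `C` is harmless.
  obtain ⟨a1, a2, a3, a4, a5⟩ := hinv v w
  simp [weylCoeff] at a1 a2 a3 a4 a5
  constructor <;> linarith

end Derivations

end KahlerAlg

/-! ### Smooth vector fields and the curvature operator. -/

namespace KahlerSurface

section VectorFields

variable {M : Type*} [TopologicalSpace M] [ChartedSpace (EuclideanSpace ℝ (Fin 4)) M]
  [IsManifold (𝓡 4) ∞ M]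

/-- The vector field `X` is smooth. -/
def IsSmoothField (X : Π y : M, TangentSpace (𝓡 4) y) : Prop :=
  ContMDiff (𝓡 4) ((𝓡 4).prod 𝓘(ℝ, EuclideanSpace ℝ (Fin 4))) ∞
    (fun y => TotalSpace.mk' (EuclideanSpace ℝ (Fin 4)) y (X y))

variable {X Y Z W : Π y : M, TangentSpace (𝓡 4) y}

lemma IsSmoothField.mdifferentiableAt (hX : IsSmoothField X) (x : M) :
    MDifferentiableAt (𝓡 4) ((𝓡 4).prod 𝓘(ℝ, EuclideanSpace ℝ (Fin 4)))
      (fun y => TotalSpace.mk' (EuclideanSpace ℝ (Fin 4)) y (X y)) x :=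
  (hX x).mdifferentiableAt (by simp)

lemma IsSmoothField.contMDiffAt_minSmoothness (hX : IsSmoothField X) (x : M) :
    ContMDiffAt (𝓡 4) ((𝓡 4).prod 𝓘(ℝ, EuclideanSpace ℝ (Fin 4))) (minSmoothness ℝ 2)
      (fun y => TotalSpace.mk' (EuclideanSpace ℝ (Fin 4)) y (X y)) x :=
  (hX x).of_le (by
    rw [minSmoothness_of_isRCLikeNormedField]
    exact WithTop.coe_le_coe.2 (le_top : (2 : ℕ∞) ≤ ⊤))

/-- Every tangent vector extends to a smooth vector field with a prescribed germ. -/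
lemma exists_isSmoothField_eventuallyEq [T2Space M] (x : M) (v : TangentSpace (𝓡 4) x) :
    ∃ X : Π y : M, TangentSpace (𝓡 4) y, IsSmoothField X ∧
      ∀ᶠ y in 𝓝 x, X y = FiberBundle.extend (EuclideanSpace ℝ (Fin 4)) v y := by
  obtain ⟨s, hs, hsm⟩ := FiberBundle.exists_contMDiffOn_extend (k := ∞) (𝓡 4)
    (EuclideanSpace ℝ (Fin 4)) v
  obtain ⟨u, hus, huo, hxu⟩ := mem_nhds_iff.mp hs
  -- A bump function supported where the local extension is smooth makes it globally smooth without
  -- changing the germ.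
  obtain ⟨ρ, -, hρ⟩ :=
    (SmoothBumpFunction.nhds_basis_tsupport (I := 𝓡 4) x).mem_iff.mp (huo.mem_nhds hxu)
  refine ⟨(ρ : M → ℝ) • FiberBundle.extend (EuclideanSpace ℝ (Fin 4)) v, ?_, ?_⟩
  · exact ContMDiffOn.smul_section_of_tsupport ρ.contMDiff.contMDiffOn huo hρ (hsm.mono hus)
  · filter_upwards [ρ.eventuallyEq_one] with y hy
    simp [hy]

lemma IsSmoothField.mlieBracket (hX : IsSmoothField X) (hY : IsSmoothField Y) :
    IsSmoothField (VectorField.mlieBracket (𝓡 4) X Y) := by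
  have : IsManifold (𝓡 4) (minSmoothness ℝ 2) M := by
    rw [minSmoothness_of_isRCLikeNormedField]; infer_instance
  have : IsManifold (𝓡 4) (((⊤ : ℕ∞) : WithTop ℕ∞) + 1) M := inferInstanceAs (IsManifold (𝓡 4) ∞ M)
  exact ContDiff.mlieBracket_vectorField (m := ⊤) (n := ⊤) hX hY (by simp)

lemma IsSmoothField.covariantDerivative
    {nabla : CovariantDerivative (𝓡 4) (EuclideanSpace ℝ (Fin 4))
      (TangentSpace (𝓡 4) : M → Type _)}
    (hs : nabla.ContMDiffCovariantDerivative ∞) (hX : IsSmoothField X) (hZ : IsSmoothField Z) :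
    IsSmoothField (fun y => nabla Z y (X y)) := by
  have := (hs.contMDiff.contMDiff (σ := Z)
    (by simpa using! hZ.contMDiffOn)).clm_bundle_apply hX.contMDiffOn
  exact contMDiffOn_univ.mp this

/-- The commutator of two vector fields as derivations is their Lie bracket. -/
lemma mvfderiv_mvfderiv_sub {f : M → ℝ} (hf : ContMDiff (𝓡 4) 𝓘(ℝ, ℝ) ∞ f)
    (hX : IsSmoothField X) (hY : IsSmoothField Y)
    (hXf : MDifferentiable (𝓡 4) 𝓘(ℝ, ℝ) fun y => mvfderiv (𝓡 4) f y (X y))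
    (hYf : MDifferentiable (𝓡 4) 𝓘(ℝ, ℝ) fun y => mvfderiv (𝓡 4) f y (Y y)) (x : M) [T2Space M] :
    mvfderiv (𝓡 4) (fun y => mvfderiv (𝓡 4) f y (Y y)) x (X x)
        - mvfderiv (𝓡 4) (fun y => mvfderiv (𝓡 4) f y (X y)) x (Y x)
      = mvfderiv (𝓡 4) f x (VectorField.mlieBracket (𝓡 4) X Y x) := by
  have : IsManifold (𝓡 4) (minSmoothness ℝ 3) M := by
    rw [minSmoothness_of_isRCLikeNormedField]; infer_instance
  have : Nontrivial (TangentSpace (𝓡 4) x) :=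
    inferInstanceAs (Nontrivial (EuclideanSpace ℝ (Fin 4)))
  -- For a field `Z` with `Z x ≠ 0`, the Jacobi identity for `X, Y, fZ` minus `f` times the one for
  -- `X, Y, Z` leaves `(XYf - YXf - [X,Y]f) Z = 0`.
  obtain ⟨v, hv⟩ := exists_ne (0 : TangentSpace (𝓡 4) x)
  obtain ⟨Z, hZ, hZv⟩ := exists_isSmoothField_eventuallyEq x v
  have hZx : Z x = v := by simpa using hZv.self_of_nhds
  have hfd : MDifferentiable (𝓡 4) 𝓘(ℝ, ℝ) f := hf.mdifferentiable (by simp)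
  have hfZ : IsSmoothField (f • Z) := ContMDiff.smul_section hf hZ
  have hexp : ∀ U : Π y : M, TangentSpace (𝓡 4) y, VectorField.mlieBracket (𝓡 4) U (f • Z) =
      (fun y => mvfderiv (𝓡 4) f y (U y)) • Z + f • VectorField.mlieBracket (𝓡 4) U Z := fun U => by
    ext1 y
    exact VectorField.mlieBracket_smul_right (hfd y) (hZ.mdifferentiableAt y)
  have hexp2 : ∀ U V : Π y : M, TangentSpace (𝓡 4) y, IsSmoothField V →
      MDifferentiable (𝓡 4) 𝓘(ℝ, ℝ) (fun y => mvfderiv (𝓡 4) f y (V y)) →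
      VectorField.mlieBracket (𝓡 4) U (VectorField.mlieBracket (𝓡 4) V (f • Z)) x =
      mvfderiv (𝓡 4) (fun y => mvfderiv (𝓡 4) f y (V y)) x (U x) • Z x
        + mvfderiv (𝓡 4) f x (V x) • VectorField.mlieBracket (𝓡 4) U Z x
        + (mvfderiv (𝓡 4) f x (U x) • VectorField.mlieBracket (𝓡 4) V Z x
          + f x • VectorField.mlieBracket (𝓡 4) U (VectorField.mlieBracket (𝓡 4) V Z) x) :=
    fun U V hV hVf => by
      have hVZ := hV.mlieBracket hZ
      rw [hexp V, VectorField.mlieBracket_add_right,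
        VectorField.mlieBracket_smul_right (hVf x) (hZ.mdifferentiableAt x),
        VectorField.mlieBracket_smul_right (hfd x) (hVZ.mdifferentiableAt x)]
      · exact (hVf x).smul_section (hZ.mdifferentiableAt x)
      · exact (hfd x).smul_section (hVZ.mdifferentiableAt x)
  have h1 := VectorField.leibniz_identity_mlieBracket_apply (hX.contMDiffAt_minSmoothness x)
      (hY.contMDiffAt_minSmoothness x) (hfZ.contMDiffAt_minSmoothness x)
  have h2 := VectorField.leibniz_identity_mlieBracket_apply (hX.contMDiffAt_minSmoothness x)
      (hY.contMDiffAt_minSmoothness x) (hZ.contMDiffAt_minSmoothness x)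
  rw [hexp2 _ _ hY hYf, hexp2 _ _ hX hXf, hexp, h2] at h1
  have h3 : (mvfderiv (𝓡 4) (fun y => mvfderiv (𝓡 4) f y (Y y)) x (X x) - mvfderiv (𝓡 4)
      (fun y => mvfderiv (𝓡 4) f y (X y)) x (Y x)
      - mvfderiv (𝓡 4) f x (VectorField.mlieBracket (𝓡 4) X Y x)) • Z x = 0 := by
    simp only [Pi.add_apply, Pi.smul_apply', smul_add] at h1
    rw [sub_smul, sub_smul]
    rw [← sub_eq_zero] at h1
    refine Eq.trans ?_ h1
    abel
  rw [hZx, smul_eq_zero_iff_left hv] at h3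
  linarith

/-- The curvature `∇_X ∇_Y Z - ∇_Y ∇_X Z - ∇_[X,Y] Z` as an operator on vector fields. -/
def fieldCurvature (nabla : CovariantDerivative (𝓡 4) (EuclideanSpace ℝ (Fin 4))
      (TangentSpace (𝓡 4) : M → Type _)) (X Y Z : Π y : M, TangentSpace (𝓡 4) y) (x : M) :
    TangentSpace (𝓡 4) x :=
  nabla (fun y => nabla Z y (Y y)) x (X x) - nabla (fun y => nabla Z y (X y)) x (Y x)
    - nabla Z x (VectorField.mlieBracket (𝓡 4) X Y x)

variable {nabla : CovariantDerivative (𝓡 4) (EuclideanSpace ℝ (Fin 4))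
      (TangentSpace (𝓡 4) : M → Type _)}

lemma fieldCurvature_swap (X Y Z : Π y : M, TangentSpace (𝓡 4) y) (x : M) :
    fieldCurvature nabla X Y Z x = -fieldCurvature nabla Y X Z x := by
  rw [fieldCurvature, fieldCurvature, VectorField.mlieBracket_swap_apply, map_neg]
  abel

/-- The curvature at a point depends only on the germs of the extensions of the vectors. -/
lemma curvature_eq_fieldCurvature (hs : nabla.ContMDiffCovariantDerivative ∞)
    {x : M} {u v w : TangentSpace (𝓡 4) x}
    (hX : IsSmoothField X) (hY : IsSmoothField Y) (hZ : IsSmoothField Z)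
    (hu : ∀ᶠ y in 𝓝 x, X y = FiberBundle.extend (EuclideanSpace ℝ (Fin 4)) u y)
    (hv : ∀ᶠ y in 𝓝 x, Y y = FiberBundle.extend (EuclideanSpace ℝ (Fin 4)) v y)
    (hw : ∀ᶠ y in 𝓝 x, Z y = FiberBundle.extend (EuclideanSpace ℝ (Fin 4)) w y) :
    curvature nabla x u v w = fieldCurvature nabla X Y Z x := by
  have hloc : ∀ {S T : Π y : M, TangentSpace (𝓡 4) y}, IsSmoothField S →
      (∀ᶠ y in 𝓝 x, S y = T y) → nabla S x = nabla T x := fun {S T} hS hST =>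
    nabla.isCovariantDerivativeOn.congr_of_eventuallyEq (hS.mdifferentiableAt x)
      ((hS.mdifferentiableAt x).congr_of_eventuallyEq (by
        filter_upwards [hST] with y hy
        rw [hy])) Filter.univ_mem hST
  -- Equality is needed near `x`, not only at `x`, because `∇Z` is differentiated again.
  have hlocZ : ∀ᶠ y in 𝓝 x, nabla Z y
      = nabla (FiberBundle.extend (EuclideanSpace ℝ (Fin 4)) w) y := by
    filter_upwards [hw.eventually_nhds] with y hy
    exact nabla.isCovariantDerivativeOn.congr_of_eventuallyEq (hZ.mdifferentiableAt y)
      ((hZ.mdifferentiableAt y).congr_of_eventuallyEq (by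
        filter_upwards [hy] with y hy
        rw [hy])) Filter.univ_mem hy
  have hux : X x = u := by simpa using hu.self_of_nhds
  have hvx : Y x = v := by simpa using hv.self_of_nhds
  have h1 := hloc (hY.covariantDerivative hs hZ)
    (T := fun y => nabla (FiberBundle.extend (EuclideanSpace ℝ (Fin 4)) w) y
      (FiberBundle.extend (EuclideanSpace ℝ (Fin 4)) v y)) (by
        filter_upwards [hlocZ, hv] with y h h'
        rw [h, h'])
  have h2 := hloc (hX.covariantDerivative hs hZ)
    (T := fun y => nabla (FiberBundle.extend (EuclideanSpace ℝ (Fin 4)) w) y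
      (FiberBundle.extend (EuclideanSpace ℝ (Fin 4)) u y)) (by
        filter_upwards [hlocZ, hu] with y h h'
        rw [h, h'])
  have h3 := Filter.EventuallyEq.mlieBracket_vectorField_eq (I := 𝓡 4) hu hv
  simp only [curvature, fieldCurvature]
  rw [h1, h2, h3, hlocZ.self_of_nhds]
  simp [hux, hvx]

/-- The first Bianchi identity. -/
lemma fieldCurvature_bianchi (hs : nabla.ContMDiffCovariantDerivative ∞) (ht : nabla.torsion = 0)
    (hX : IsSmoothField X) (hY : IsSmoothField Y) (hZ : IsSmoothField Z) (x : M) :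
    fieldCurvature nabla X Y Z x + fieldCurvature nabla Y Z X x + fieldCurvature nabla Z X Y x
      = 0 := by
  have : IsManifold (𝓡 4) (minSmoothness ℝ 3) M := by
    rw [minSmoothness_of_isRCLikeNormedField]; infer_instance
  have htor : ∀ {U V : Π y : M, TangentSpace (𝓡 4) y}, IsSmoothField U → IsSmoothField V → ∀ y,
      nabla V y (U y) = nabla U y (V y) + VectorField.mlieBracket (𝓡 4) U V y :=
    fun hU hV y => by
      rw [← nabla.torsion_eq_zero_iff.mp ht (hU.mdifferentiableAt y) (hV.mdifferentiableAt y)]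
      abel
  -- Without torsion, second derivatives cancel in the cyclic sum up to `∇_X [Y,Z] - ∇_[Y,Z] X =
  -- [X,[Y,Z]]` and its cyclic images, and the Jacobi identity finishes.
  have hadd : ∀ {U V : Π y : M, TangentSpace (𝓡 4) y}, IsSmoothField U → IsSmoothField V →
      nabla (fun y => nabla V y (U y)) x = nabla (fun y => nabla U y (V y)) x
        + nabla (VectorField.mlieBracket (𝓡 4) U V) x := fun hU hV => by
    rw [← nabla.isCovariantDerivativeOn.add ((hV.covariantDerivative hs hU).mdifferentiableAt x)
      ((hU.mlieBracket hV).mdifferentiableAt x)]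
    congr 1
    ext1 y
    exact htor hU hV y
  have e1 := hadd hX hY
  have e2 := hadd hY hZ
  have e3 := hadd hZ hX
  have j := VectorField.leibniz_identity_mlieBracket_apply (hX.contMDiffAt_minSmoothness x)
      (hY.contMDiffAt_minSmoothness x) (hZ.contMDiffAt_minSmoothness x)
  simp only [fieldCurvature]
  rw [e1, e2, e3]
  simp only [add_apply]
  have j1 : VectorField.mlieBracket (𝓡 4) Y (VectorField.mlieBracket (𝓡 4) Z X) x
      = -VectorField.mlieBracket (𝓡 4) Y (VectorField.mlieBracket (𝓡 4) X Z) x := by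
    have := VectorField.mlieBracket_const_smul_right (I := 𝓡 4) (V := Y) (c := (-1 : ℝ))
      ((hX.mlieBracket hZ).mdifferentiableAt x)
    rwa [neg_one_smul, neg_one_smul, ← VectorField.mlieBracket_swap] at this
  rw [htor hX (hY.mlieBracket hZ), htor hY (hZ.mlieBracket hX), htor hZ (hX.mlieBracket hY), j, j1,
    VectorField.mlieBracket_swap_apply (V := Z) (W := VectorField.mlieBracket (𝓡 4) X Y)]
  abel

section Metric

variable [RiemannianBundle (fun x : M => TangentSpace (𝓡 4) x)]
    [IsContMDiffRiemannianBundle (𝓡 4) ∞ (EuclideanSpace ℝ (Fin 4))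
      (fun x : M => TangentSpace (𝓡 4) x)]

/-- The curvature of a metric connection is skew-symmetric. -/
lemma inner_fieldCurvature_right [T2Space M] (hs : nabla.ContMDiffCovariantDerivative ∞)
    (hm : nabla.IsMetricCompatible)
    (hX : IsSmoothField X) (hY : IsSmoothField Y) (hZ : IsSmoothField Z) (hW : IsSmoothField W)
    (x : M) : (inner ℝ (fieldCurvature nabla X Y Z x) (W x) : ℝ)
      = -inner ℝ (fieldCurvature nabla X Y W x) (Z x) := by
  have hin : ∀ {S T : Π y : M, TangentSpace (𝓡 4) y}, IsSmoothField S → IsSmoothField T →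
      ContMDiff (𝓡 4) 𝓘(ℝ, ℝ) ∞ fun y => (inner ℝ (S y) (T y) : ℝ) := fun hS hT =>
    ContMDiff.inner_bundle hS hT
  have hd : ∀ {S T : Π y : M, TangentSpace (𝓡 4) y}, IsSmoothField S → IsSmoothField T →
      MDifferentiable (𝓡 4) 𝓘(ℝ, ℝ) fun y => (inner ℝ (S y) (T y) : ℝ) := fun hS hT =>
    (hin hS hT).mdifferentiable (by simp)
  have h1 : ∀ (U : Π y : M, TangentSpace (𝓡 4) y) {S T : Π y : M, TangentSpace (𝓡 4) y},
      IsSmoothField S → IsSmoothField T → ∀ y,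
      mvfderiv (𝓡 4) (fun y => (inner ℝ (S y) (T y) : ℝ)) y (U y)
        = inner ℝ (nabla S y (U y)) (T y) + inner ℝ (S y) (nabla T y (U y)) := fun U S T hS hT y =>
    hm.mvfderiv_inner_eq U (hS.mdifferentiableAt y) (hT.mdifferentiableAt y)
  have h1' : ∀ (U : Π y : M, TangentSpace (𝓡 4) y),
      (fun y => mvfderiv (𝓡 4) (fun y => (inner ℝ (Z y) (W y) : ℝ)) y (U y))
        = (fun y => (inner ℝ (nabla Z y (U y)) (W y) : ℝ)) + fun y => (inner ℝ (Z y) (nabla W y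
            (U y)) : ℝ) :=
    fun U => funext fun y => h1 U hZ hW y
  have hdd : ∀ {U : Π y : M, TangentSpace (𝓡 4) y}, IsSmoothField U →
      MDifferentiable (𝓡 4) 𝓘(ℝ, ℝ) fun y =>
        mvfderiv (𝓡 4) (fun y => (inner ℝ (Z y) (W y) : ℝ)) y (U y) := fun hU => by
    rw [h1']
    exact (hd (hU.covariantDerivative hs hZ) hW).add (hd hZ (hU.covariantDerivative hs hW))
  -- The operator `XY - YX - [X,Y]` kills the function `g(Z,W)`. Expanding by metric compatibility,
  -- the products of first derivatives cancel and leave `g(R(X,Y)Z,W) + g(Z,R(X,Y)W) = 0`.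
  have key := mvfderiv_mvfderiv_sub (hin hZ hW) hX hY (hdd hX) (hdd hY) x
  have h2 : ∀ (U : Π y : M, TangentSpace (𝓡 4) y) {V : Π y : M, TangentSpace (𝓡 4) y},
      IsSmoothField V →
      mvfderiv (𝓡 4) (fun y => mvfderiv (𝓡 4) (fun y => (inner ℝ (Z y) (W y) : ℝ)) y (V y)) x (U x)
        = inner ℝ (nabla (fun y => nabla Z y (V y)) x (U x)) (W x)
          + inner ℝ (nabla Z x (V x)) (nabla W x (U x))
          + (inner ℝ (nabla Z x (U x)) (nabla W x (V x))
          + inner ℝ (Z x) (nabla (fun y => nabla W y (V y)) x (U x))) := fun U V hV => by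
    have hVZ := hV.covariantDerivative hs hZ
    have hVW := hV.covariantDerivative hs hW
    rw [h1', mvfderiv_add (hd hVZ hW x) (hd hZ hVW x), add_apply,
      h1 U hVZ hW, h1 U hZ hVW]
  rw [h2 X hY, h2 Y hX, h1 _ hZ hW] at key
  rw [real_inner_comm (Z x)]
  simp only [fieldCurvature, inner_sub_left, inner_sub_right]
  linarith

end Metric

end VectorFields

end KahlerSurface

/-! ### Symmetries of the curvature tensor of a Kähler metric. -/

namespace KahlerSurface

section Symmetries

variable {M : Type*} [TopologicalSpace M] [T2Space M] [ChartedSpace (EuclideanSpace ℝ (Fin 4)) M]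
  [IsManifold (𝓡 4) ∞ M]
  [RiemannianBundle (fun x : M => TangentSpace (𝓡 4) x)]
  [IsContMDiffRiemannianBundle (𝓡 4) ∞ (EuclideanSpace ℝ (Fin 4))
      (fun x : M => TangentSpace (𝓡 4) x)]
  {nabla : CovariantDerivative (𝓡 4) (EuclideanSpace ℝ (Fin 4))
      (TangentSpace (𝓡 4) : M → Type _)}

variable (x : M) (u v w z : TangentSpace (𝓡 4) x)

lemma IsLeviCivita.curvature4_swap (h : IsLeviCivita nabla) :
    curvature4 nabla x u v w z = -curvature4 nabla x v u w z := by
  obtain ⟨X, hX, hu⟩ := exists_isSmoothField_eventuallyEq x u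
  obtain ⟨Y, hY, hv⟩ := exists_isSmoothField_eventuallyEq x v
  obtain ⟨Z, hZ, hw⟩ := exists_isSmoothField_eventuallyEq x w
  rw [curvature4, curvature4, curvature_eq_fieldCurvature h.smooth hX hY hZ hu hv hw,
    curvature_eq_fieldCurvature h.smooth hY hX hZ hv hu hw, fieldCurvature_swap, inner_neg_left]

lemma IsLeviCivita.curvature4_bianchi (h : IsLeviCivita nabla) :
    curvature4 nabla x u v w z + curvature4 nabla x v w u z + curvature4 nabla x w u v z = 0 := by
  obtain ⟨X, hX, hu⟩ := exists_isSmoothField_eventuallyEq x u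
  obtain ⟨Y, hY, hv⟩ := exists_isSmoothField_eventuallyEq x v
  obtain ⟨Z, hZ, hw⟩ := exists_isSmoothField_eventuallyEq x w
  simp only [curvature4]
  rw [curvature_eq_fieldCurvature h.smooth hX hY hZ hu hv hw,
    curvature_eq_fieldCurvature h.smooth hY hZ hX hv hw hu,
    curvature_eq_fieldCurvature h.smooth hZ hX hY hw hu hv, ← inner_add_left, ← inner_add_left,
    fieldCurvature_bianchi h.smooth h.torsion_free hX hY hZ, inner_zero_left]

/-- The curvature is tensorial in the vector field that is differentiated. -/
lemma IsLeviCivita.inner_fieldCurvature_eq_curvature4 (h : IsLeviCivita nabla)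
    {X Y Z : Π y : M, TangentSpace (𝓡 4) y}
    (hX : IsSmoothField X) (hY : IsSmoothField Y) (hZ : IsSmoothField Z) {x : M}
    {u v : TangentSpace (𝓡 4) x} (z : TangentSpace (𝓡 4) x)
    (hu : ∀ᶠ y in 𝓝 x, X y = FiberBundle.extend (EuclideanSpace ℝ (Fin 4)) u y)
    (hv : ∀ᶠ y in 𝓝 x, Y y = FiberBundle.extend (EuclideanSpace ℝ (Fin 4)) v y) :
    inner ℝ (fieldCurvature nabla X Y Z x) z = curvature4 nabla x u v (Z x) z := by
  obtain ⟨Z', hZ', hz'⟩ := exists_isSmoothField_eventuallyEq x (Z x)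
  obtain ⟨W, hW, hw⟩ := exists_isSmoothField_eventuallyEq x z
  have e1 : Z' x = Z x := by simpa using hz'.self_of_nhds
  have e2 : W x = z := by simpa using hw.self_of_nhds
  -- Skew-symmetry moves `Z` and `Z'` into the undifferentiated slot, where only their common value
  -- at `x` matters.
  rw [curvature4, curvature_eq_fieldCurvature h.smooth hX hY hZ' hu hv hz', ← e2,
    inner_fieldCurvature_right h.smooth h.metric hX hY hZ hW,
    inner_fieldCurvature_right h.smooth h.metric hX hY hZ' hW, e1]

lemma IsLeviCivita.curvature4_swap_right (h : IsLeviCivita nabla) :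
    curvature4 nabla x u v w z = -curvature4 nabla x u v z w := by
  obtain ⟨X, hX, hu⟩ := exists_isSmoothField_eventuallyEq x u
  obtain ⟨Y, hY, hv⟩ := exists_isSmoothField_eventuallyEq x v
  obtain ⟨Z, hZ, hw⟩ := exists_isSmoothField_eventuallyEq x w
  obtain ⟨W, hW, hz⟩ := exists_isSmoothField_eventuallyEq x z
  have e1 : Z x = w := by simpa using hw.self_of_nhds
  have e2 : W x = z := by simpa using hz.self_of_nhds
  rw [curvature4, curvature4, curvature_eq_fieldCurvature h.smooth hX hY hZ hu hv hw,
    curvature_eq_fieldCurvature h.smooth hX hY hW hu hv hz, ← e1, ← e2,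
    inner_fieldCurvature_right h.smooth h.metric hX hY hZ hW]

variable {J : Π x : M, TangentSpace (𝓡 4) x →L[ℝ] TangentSpace (𝓡 4) x}

/-- The curvature of a Kähler metric commutes with the complex structure. -/
lemma IsKahler.curvature4_apply_apply (h : IsLeviCivita nabla) (hJ : IsKahler nabla J) :
    curvature4 nabla x u v (J x w) (J x z) = curvature4 nabla x u v w z := by
  obtain ⟨X, hX, hu⟩ := exists_isSmoothField_eventuallyEq x u
  obtain ⟨Y, hY, hv⟩ := exists_isSmoothField_eventuallyEq x v
  obtain ⟨Z, hZ, hw⟩ := exists_isSmoothField_eventuallyEq x w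
  have hJs : ∀ {U : Π y : M, TangentSpace (𝓡 4) y}, IsSmoothField U →
      IsSmoothField fun y => J y (U y) := fun hU => hJ.smooth.clm_bundle_apply hU
  have hp : ∀ {U : Π y : M, TangentSpace (𝓡 4) y}, IsSmoothField U → ∀ y t,
      nabla (fun y => J y (U y)) y t = J y (nabla U y t) := fun hU y t =>
    hJ.parallel _ y (hU.mdifferentiableAt y) t
  have hcomm : fieldCurvature nabla X Y (fun y => J y (Z y)) x
      = J x (fieldCurvature nabla X Y Z x) := by
    simp only [fieldCurvature, hp hZ, hp (hX.covariantDerivative h.smooth hZ),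
      hp (hY.covariantDerivative h.smooth hZ), map_sub]
  have e1 : Z x = w := by simpa using hw.self_of_nhds
  -- The field `JZ` need not have the germ of the chosen extension of `J w`, so tensoriality is
  -- required here.
  rw [← e1, ← h.inner_fieldCurvature_eq_curvature4 hX hY hZ z hu hv,
    ← h.inner_fieldCurvature_eq_curvature4 hX hY (hJs hZ) (J x z) hu hv, hcomm, hJ.orthogonal]

end Symmetries

end KahlerSurface
end

/-! ### The pointwise result applied to the curvature tensor. -/

theorem proposition6 {M : Type*} [TopologicalSpace M] [T2Space M] [SecondCountableTopology M]
    [ChartedSpace (EuclideanSpace ℝ (Fin 4)) M] [IsManifold (𝓡 4) ∞ M]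
    [RiemannianBundle (fun x : M => TangentSpace (𝓡 4) x)]
    [IsContMDiffRiemannianBundle (𝓡 4) ∞ (EuclideanSpace ℝ (Fin 4))
      (fun x : M => TangentSpace (𝓡 4) x)]
    (nabla : CovariantDerivative (𝓡 4) (EuclideanSpace ℝ (Fin 4))
      (TangentSpace (𝓡 4) : M → Type _))
    (hnabla : KahlerSurface.IsLeviCivita nabla)
    (J : Π x : M, TangentSpace (𝓡 4) x →L[ℝ] TangentSpace (𝓡 4) x)
    (hJ : KahlerSurface.IsKahler nabla J)
    (D : Π x : M, Submodule ℝ (TangentSpace (𝓡 4) x))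
    (hD : KahlerSurface.IsQCH nabla J D)
    (hW : KahlerSurface.CurvatureAnnihilates nabla (KahlerSurface.weylMinusTensor nabla J))
    (hkappa : ∀ x : M, KahlerSurface.kappa nabla J D x ≠ 0) :
    KahlerSurface.IsSemiSymmetric nabla := by
  intro x u v z₁ z₂ z₃ z₄
  refine KahlerAlg.derivAction_eq_zero_of_weylMinus (V := TangentSpace (𝓡 4) x)
    (finrank_euclideanSpace_fin : Module.finrank ℝ (EuclideanSpace ℝ (Fin 4)) = 4)
    (J x).toLinearMap (hJ.sq x) (hJ.orthogonal x) (KahlerSurface.curvature nabla x)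
    (KahlerSurface.curvature4 nabla x) (fun _ _ _ _ => rfl)
    (fun _ _ _ _ => hnabla.curvature4_swap ..) (fun _ _ _ _ => hnabla.curvature4_swap_right ..)
    (fun _ _ _ _ => hnabla.curvature4_bianchi ..)
    (fun _ _ _ _ => hJ.curvature4_apply_apply _ _ _ _ _ hnabla) ?_ (hW x) u v z₁ z₂ z₃ z₄
  -- `κ` is a contraction of `W⁻`, so it would vanish at `x` together with `W⁻`.
  intro h
  refine hkappa x ?_
  change KahlerAlg.weylMinus (fun u => J x u) (KahlerSurface.curvature4 nabla x) = 0 at h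
  simp [KahlerSurface.kappa, KahlerAlg.conformalScalar, h]
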